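/- Let $Q$ be a finite group acting transitively (not necessarily faithfully) on a finite set $X$ with $|X| \ge 2$. Set $W(Q,0) = \{1\}$ and $W(Q,k+1) = W(Q,k) \wr_X Q = W(Q,k)^X \rtimes Q$ for $k \ge 0$, where $Q$ acts on $W(Q,k)^X$ by $(q b)(x) = b(q^{-1}x)$. Let $\pi_k \colon W(Q,k+1) \to W(Q,k)$ be the natural epimorphisms: $\pi_0$ is trivial and $\pi_{k+1}(b,q) = (\pi_k \circ b, q)$ for $b \in W(Q,k+1)^X$, $q \in Q$ (equivalently, $\pi_k$ is the projection onto the second factor in the decomposition $W(Q,k+1) = Q \wr_{X^k} W(Q,k) = Q^{X^k} \rtimes W(Q,k)$). Let $W^{\mathrm{prof}}(Q) = \varprojlim_k W(Q,k)$ be the corresponding profinite group. Then the following properties are equivalent: (i) the finite group $Q$ is perfect, i.e. $Q = [Q,Q]$; (ii) the profinite group $W^{\mathrm{prof}}(Q)$ is rigid, i.e. for every $n \ge 1$ it has only finitely many equivalence classes of continuous irreducible complex linear representations of degree $n$. -/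

import Mathlib

universe u v w

/-! ### Permutational wreath products -/

/-- The permutational wreath product `H ≀_X Q = H^X ⋊ Q`, where `Q` acts on `H^X = (X → H)` by
`(q • b) x = b (q⁻¹ • x)` (this is Mathlib's `mulAutArrow`). -/
abbrev PermWreath (H : Type w) (X : Type v) (Q : Type u) [Group H] [Group Q] [MulAction Q X] :
    Type (max u v w) :=
  SemidirectProduct (X → H) Q mulAutArrow

/-- Functoriality in the base group: `f : H → H'` induces `H ≀_X Q → H' ≀_X Q`,
`(b, q) ↦ (f ∘ b, q)`. -/
def PermWreath.map {H H' : Type w} (X : Type v) (Q : Type u) [Group H] [Group H'] [Group Q]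
    [MulAction Q X] (f : H →* H') : PermWreath H X Q →* PermWreath H' X Q :=
  SemidirectProduct.map (f.compLeft X) (MonoidHom.id Q) (fun _ => rfl)

/-! ### Iterated wreath products and their inverse limit -/

/-- The tower `W(Q,0) = {1}`, `W(Q,k+1) = W(Q,k) ≀_X Q`, as bundled groups. -/
def iterWreathGrp (Q : Type u) (X : Type v) [Group Q] [MulAction Q X] : ℕ → GrpCat.{max u v}
  | 0 => GrpCat.of PUnit
  | k + 1 => GrpCat.of (PermWreath (iterWreathGrp Q X k) X Q)

/-- The group `W(Q,k)`. -/
def IterWreath (Q : Type u) (X : Type v) [Group Q] [MulAction Q X] (k : ℕ) : Type (max u v) :=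
  iterWreathGrp Q X k

instance instGroupIterWreath (Q : Type u) (X : Type v) [Group Q] [MulAction Q X] (k : ℕ) :
    Group (IterWreath Q X k) :=
  inferInstanceAs (Group (iterWreathGrp Q X k))

/-- The finite groups `W(Q,k)` carry the discrete topology. -/
instance instTopologicalSpaceIterWreath (Q : Type u) (X : Type v) [Group Q] [MulAction Q X]
    (k : ℕ) : TopologicalSpace (IterWreath Q X k) := ⊥

instance instDiscreteTopologyIterWreath (Q : Type u) (X : Type v) [Group Q] [MulAction Q X]
    (k : ℕ) : DiscreteTopology (IterWreath Q X k) := ⟨rfl⟩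

/-- The natural epimorphism `W(Q,k+1) → W(Q,k)`. It is the projection of
`W(Q,k+1) = Q ≀_{X^k} W(Q,k)` onto `W(Q,k)`; on the words `X^(k+1)` of length `k+1` it corresponds to
the induced action on their prefixes of length `k`. In terms of the decomposition
`W(Q,k+1) = W(Q,k) ≀_X Q`, it is trivial for `k = 0`, and `W(Q,k+2) → W(Q,k+1)` is
induced by `W(Q,k+1) → W(Q,k)` on the base groups. -/
def IterWreath.proj (Q : Type u) (X : Type v) [Group Q] [MulAction Q X] :
    (k : ℕ) → IterWreath Q X (k + 1) →* IterWreath Q X k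
  | 0 => 1
  | k + 1 => PermWreath.map X Q (IterWreath.proj Q X k)

/-- The profinite iterated wreath product `W^prof(Q) = lim← W(Q,k)`: the subgroup of coherent
sequences in `∏ k, W(Q,k)`. As a subgroup of this product it carries the subspace topology of the
product topology, hence the inverse limit topology. -/
def WProf (Q : Type u) (X : Type v) [Group Q] [MulAction Q X] :
    Subgroup ((k : ℕ) → IterWreath Q X k) where
  carrier := {g | ∀ k, IterWreath.proj Q X k (g (k + 1)) = g k}
  one_mem' := fun _ => map_one _
  mul_mem' := fun {a b} ha hb k =>
    (map_mul (IterWreath.proj Q X k) (a (k + 1)) (b (k + 1))).trans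
      (congrArg₂ (· * ·) (ha k) (hb k))
  inv_mem' := fun {a} ha k =>
    (map_inv (IterWreath.proj Q X k) (a (k + 1))).trans (congrArg (·⁻¹) (ha k))

/-! ### Continuous irreducible representations and rigidity -/

/-- The continuous irreducible complex linear representations of degree `n` of a topological group
`G`, realised on `ℂ^n` (every `n`-dimensional complex representation is equivalent to one on `ℂ^n`).
On a finite-dimensional space, continuity of `G → GL(V)` amounts to continuity of all orbit maps
`g ↦ ρ g v`. -/
def ContIrrep (G : Type w) [Group G] [TopologicalSpace G] (n : ℕ) : Type w :=
  {ρ : Representation ℂ G (Fin n → ℂ) // ρ.IsIrreducible ∧ ∀ v, Continuous fun g : G => ρ g v}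

/-- Equivalence of representations: existence of a `G`-equivariant linear isomorphism. -/
instance ContIrrep.setoid (G : Type w) [Group G] [TopologicalSpace G] (n : ℕ) :
    Setoid (ContIrrep G n) where
  r ρ σ := Nonempty (Representation.Equiv ρ.1 σ.1)
  iseqv :=
    { refl := fun ρ => ⟨Representation.Equiv.refl ρ.1⟩
      symm := fun ⟨e⟩ => ⟨e.symm⟩
      trans := fun ⟨e⟩ ⟨f⟩ => ⟨e.trans f⟩ }

/-- `r_n(G) ∈ {0, 1, 2, …, ∞}`: the number of equivalence classes of continuous irreducible complex
representations of degree `n`. -/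
noncomputable def repCount (G : Type w) [Group G] [TopologicalSpace G] (n : ℕ) : ℕ∞ :=
  ENat.card (Quotient (ContIrrep.setoid G n))

/-- A topological group `G` is rigid if `r_n(G) < ∞` for all `n ≥ 1`. -/
def IsRigid (G : Type w) [Group G] [TopologicalSpace G] [IsTopologicalGroup G] : Prop :=
  ∀ n : ℕ, 1 ≤ n → repCount G n < ⊤

/-! ### Perfect groups -/

/-! If `Q` is perfect, so is every `W(Q,k)`, and representations of degree at most `k + 1` of any
`W(Q,m)` kill the kernel of `trunc` to `W(Q,k)`. The induction step is
`PermWreath.apply_inl_eq_one`: distinct factors of `H^X` commute, so if one acts irreducibly,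
Schur's lemma makes another act by scalars, hence trivially, and transitivity spreads this to all
factors; otherwise Maschke's theorem lowers the degree. A continuous representation factors through
some finite level because `GL_n(ℂ)` has no small subgroups, so in degree `k + 1` it comes from the
finite group `W(Q,k)`. Conversely, a nontrivial character of `Q`, multiplied over the vertices of
each level, yields infinitely many continuous characters. -/

theorem Group.IsPerfect.map_eq_one_of_commute {G M : Type*} [Group G] [Monoid M]
    [Group.IsPerfect G] (f : G →* M) (hf : ∀ a b, Commute (f a) (f b)) (g : G) : f g = 1 := by
  have h : commutator G ≤ f.toHomUnits.ker := by
    rw [commutator_def, Subgroup.commutator_le]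
    intro a _ b _
    rw [MonoidHom.mem_ker, map_commutatorElement, commutatorElement_eq_one_iff_mul_comm]
    exact Units.ext (hf a b)
  exact congrArg Units.val (h (Group.IsPerfect.mem_commutator (g := g)))

theorem Group.IsPerfect.map_mem_commutator {G G' : Type*} [Group G] [Group G']
    [Group.IsPerfect G] (f : G →* G') (g : G) : f g ∈ commutator G' := by
  have h : f g ∈ (commutator G).map f := ⟨g, Group.IsPerfect.mem_commutator, rfl⟩
  rw [commutator_def, Subgroup.map_commutator] at h
  exact Subgroup.commutator_mono le_top le_top h

/-- As `X` is finite, the group is generated by `Q` and the factors of `H^X`, all of them perfect.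
-/
instance PermWreath.isPerfect {H : Type w} {X : Type v} {Q : Type u} [Group H] [Group Q]
    [MulAction Q X] [Finite X] [Group.IsPerfect H] [Group.IsPerfect Q] :
    Group.IsPerfect (PermWreath H X Q) := by
  classical
  refine ⟨eq_top_iff.mpr fun g _ => ?_⟩
  rw [← SemidirectProduct.inl_left_mul_inr_right g]
  refine mul_mem ?_ (Group.IsPerfect.map_mem_commutator _ _)
  refine Subgroup.pi_mem_of_mulSingle_mem
    (H := (commutator (PermWreath H X Q)).comap SemidirectProduct.inl) g.left fun x => ?_
  exact Group.IsPerfect.map_mem_commutator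
    (SemidirectProduct.inl.comp (MonoidHom.mulSingle (fun _ : X => H) x)) (g.left x)

theorem Group.exists_hom_units_complex_ne_one {G : Type*} [Group G] [Finite G]
    (hG : ¬ Group.IsPerfect G) : ∃ (χ : G →* ℂˣ) (g : G), χ g ≠ 1 := by
  obtain ⟨g, hg⟩ : ∃ g : G, g ∉ commutator G := by
    by_contra! h
    exact hG ⟨eq_top_iff.mpr fun g _ => h g⟩
  have hg' : Abelianization.of g ≠ 1 := fun h => hg <| by
    rwa [← MonoidHom.mem_ker, Abelianization.ker_of] at h
  obtain ⟨φ, hφ⟩ :=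
    CommGroup.exists_apply_ne_one_of_hasEnoughRootsOfUnity (Abelianization G) ℂ hg'
  exact ⟨φ.comp Abelianization.of, g, hφ⟩

/-! ### Representations of finite groups -/

namespace Representation

theorem finrank_le_one_apply_eq_one {G V : Type*} [Group G] [Group.IsPerfect G] [AddCommGroup V]
    [Module ℂ V] [FiniteDimensional ℂ V] (hV : Module.finrank ℂ V ≤ 1) (ρ : Representation ℂ G V)
    (g : G) : ρ g = 1 := by
  refine Group.IsPerfect.map_eq_one_of_commute ρ (fun a b => ?_) g
  obtain ⟨v, hv⟩ := finrank_le_one_iff.mp hV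
  ext w
  obtain ⟨c, rfl⟩ := hv w
  obtain ⟨a', ha⟩ := hv (ρ a v)
  obtain ⟨b', hb⟩ := hv (ρ b v)
  simp only [Module.End.mul_apply, map_smul, ← ha, ← hb]
  rw [smul_comm a' b']

/-- Elements acting trivially on all representations of smaller dimension act trivially on a
reducible representation. -/
theorem apply_eq_one_of_not_isIrreducible {G V : Type*} [Group G] [Finite G] [AddCommGroup V]
    [Module ℂ V] [FiniteDimensional ℂ V] (ρ : Representation ℂ G V) (hρ : ¬ ρ.IsIrreducible)
    (g : G) (hg : ∀ (U : Subrepresentation ρ),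
      Module.finrank ℂ U.toSubmodule < Module.finrank ℂ V → U.toRepresentation g = 1) :
    ρ g = 1 := by
  rcases subsingleton_or_nontrivial V with hV | hV
  · ext v
    exact Subsingleton.elim _ _
  obtain ⟨U, hU, hU'⟩ : ∃ U : Subrepresentation ρ, U ≠ ⊥ ∧ U ≠ ⊤ := by
    by_contra! h
    have : Nontrivial (Subrepresentation ρ) :=
      ⟨⊥, ⊤, fun h => bot_ne_top (α := Submodule ℂ V) (congrArg (·.toSubmodule) h)⟩
    exact hρ ⟨fun U => or_iff_not_imp_left.mpr (h U)⟩
  -- Maschke's theorem: `U` has an invariant complement, and both summands are proper.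
  have : IsSemisimpleRepresentation ρ := inferInstance
  obtain ⟨U', hc⟩ := exists_isCompl U
  have hsup : U.toSubmodule ⊔ U'.toSubmodule = ⊤ :=
    congrArg (·.toSubmodule) hc.sup_eq_top
  have hlt : ∀ W : Subrepresentation ρ, W ≠ ⊤ →
      Module.finrank ℂ W.toSubmodule < Module.finrank ℂ V := fun W hW =>
    Submodule.finrank_lt fun h => hW (Subrepresentation.toSubmodule_injective h)
  have hfix : ∀ W : Subrepresentation ρ, W ≠ ⊤ → ∀ v ∈ W.toSubmodule, ρ g v = v :=
    fun W hW v hv => congrArg Subtype.val (LinearMap.congr_fun (hg W (hlt W hW)) ⟨v, hv⟩)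
  have hU'' : U' ≠ ⊤ := fun h => hU (by simpa [h] using hc.inf_eq_bot)
  ext v
  obtain ⟨a, ha, b, hb, rfl⟩ := Submodule.mem_sup.mp (hsup ▸ Submodule.mem_top (x := v))
  rw [map_add, hfix U hU' a ha, hfix U' hU'' b hb, Module.End.one_apply]

/-- Schur's lemma: a linear map commuting with an irreducible representation is a scalar. -/
theorem IsIrreducible.exists_eq_smul_one {G V : Type*} [Group G] [AddCommGroup V]
    [Module ℂ V] [FiniteDimensional ℂ V] (ρ : Representation ℂ G V) [ρ.IsIrreducible]
    (f : Module.End ℂ V) (hf : ∀ g, Commute f (ρ g)) : ∃ c : ℂ, f = c • 1 := by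
  obtain ⟨c, hc⟩ :=
    (IsIrreducible.algebraMap_intertwiningMap_bijective_of_isAlgClosed (ρ := ρ)).2 ⟨f, hf⟩
  exact ⟨c, (congrArg (·.toLinearMap) hc).symm⟩

open scoped MonoidAlgebra in
-- Every simple module embeds in the regular module, so its isotypic component there is nonzero and
-- determines it.
theorem nonempty_equiv_of_isotypicComponent_eq {G V W : Type*} [Group G] [Finite G]
    [AddCommGroup V] [Module ℂ V] [AddCommGroup W] [Module ℂ W]
    (ρ : Representation ℂ G V) (σ : Representation ℂ G W) [ρ.IsIrreducible] [σ.IsIrreducible]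
    (h : isotypicComponent ℂ[G] ℂ[G] ρ.asModule = isotypicComponent ℂ[G] ℂ[G] σ.asModule) :
    Nonempty (ρ.Equiv σ) := by
  obtain ⟨I, ⟨e⟩⟩ :=
    IsSemisimpleRing.exists_linearEquiv_ideal_of_isSimpleModule ℂ[G] ρ.asModule
  have hI : IsSimpleModule ℂ[G] I := .congr e.symm
  have hle : I ≤ isotypicComponent ℂ[G] ℂ[G] σ.asModule := by
    rw [← h, e.isotypicComponent_eq]
    exact Submodule.le_isotypicComponent I
  obtain ⟨e'⟩ := isIsotypicOfType_submodule_iff.mp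
    (IsIsotypicOfType.isotypicComponent ℂ[G] ℂ[G] σ.asModule) I hle
  exact ⟨((IntertwiningMap.equivLinearMapAsModule ρ σ).symm (e.trans e').toLinearMap).ofBijective
    (e.trans e').bijective⟩

end Representation

open scoped MonoidAlgebra in
theorem ContIrrep.finite_quotient_of_finite (G : Type w) [Group G] [Finite G]
    [TopologicalSpace G] (n : ℕ) : Finite (Quotient (ContIrrep.setoid G n)) := by
  have hirr : ∀ q : Quotient (ContIrrep.setoid G n), q.out.1.IsIrreducible := fun q => q.out.2.1
  have hmem : ∀ q : Quotient (ContIrrep.setoid G n),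
      isotypicComponent ℂ[G] ℂ[G] q.out.1.asModule ∈ isotypicComponents ℂ[G] ℂ[G] := by
    intro q
    obtain ⟨I, ⟨e⟩⟩ :=
      IsSemisimpleRing.exists_linearEquiv_ideal_of_isSimpleModule ℂ[G] q.out.1.asModule
    exact ⟨I, .congr e.symm, e.isotypicComponent_eq⟩
  refine Finite.of_injective (β := isotypicComponents ℂ[G] ℂ[G])
    (fun q => ⟨isotypicComponent ℂ[G] ℂ[G] q.out.1.asModule, hmem q⟩) fun q q' h => ?_
  rw [← q.out_eq, ← q'.out_eq]
  exact Quotient.sound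
    (Representation.nonempty_equiv_of_isotypicComponent_eq _ _ (congrArg Subtype.val h))

/-! ### Representations of wreath products -/

/-- The embedding of the base group `H` as the factor of `H ≀_X Q` indexed by `x`. -/
def PermWreath.single {H : Type w} {X : Type v} (Q : Type u) [Group H] [Group Q]
    [MulAction Q X] [DecidableEq X] (x : X) : H →* PermWreath H X Q :=
  SemidirectProduct.inl.comp (MonoidHom.mulSingle (fun _ : X => H) x)

theorem PermWreath.inr_mul_single_mul_inv {H : Type w} {X : Type v} {Q : Type u} [Group H]
    [Group Q] [MulAction Q X] [DecidableEq X] (q : Q) (x : X) (h : H) :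
    (SemidirectProduct.inr q : PermWreath H X Q) * PermWreath.single Q x h *
      (SemidirectProduct.inr q)⁻¹ = PermWreath.single Q (q • x) h := by
  rw [← map_inv]
  refine (SemidirectProduct.inl_aut q _).symm.trans (congrArg _ (funext fun y => ?_))
  change (Pi.mulSingle x h : X → H) (q⁻¹ • y) = (Pi.mulSingle (q • x) h : X → H) y
  simp [Pi.mulSingle_apply, inv_smul_eq_iff]

theorem PermWreath.commute_single {H : Type w} {X : Type v} {Q : Type u} [Group H]
    [Group Q] [MulAction Q X] [DecidableEq X] {x y : X} (hxy : x ≠ y) (h h' : H) :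
    Commute (PermWreath.single Q x h) (PermWreath.single Q y h') :=
  (Pi.mulSingle_commute (f := fun _ : X => H) hxy h h').map SemidirectProduct.inl

/-- If elements of `N` act trivially in all representations of degree at most `d` of the perfect
group `H`, then `N^X` acts trivially in all representations of degree at most `d + 1`
of `H ≀_X Q`. -/
theorem PermWreath.apply_inl_eq_one {H : Type w} {X : Type v} {Q : Type u} [Group H] [Finite H]
    [Group.IsPerfect H] [Group Q] [MulAction Q X] [MulAction.IsPretransitive Q X] [Finite X]
    (hX : 2 ≤ Nat.card X) (N : Set H) (d : ℕ)
    (hN : ∀ (V : Type) [AddCommGroup V] [Module ℂ V] [FiniteDimensional ℂ V]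
      (ρ : Representation ℂ H V), Module.finrank ℂ V ≤ d → ∀ n ∈ N, ρ n = 1)
    (V : Type) [AddCommGroup V] [Module ℂ V] [FiniteDimensional ℂ V]
    (ρ : Representation ℂ (PermWreath H X Q) V) (hV : Module.finrank ℂ V ≤ d + 1)
    (b : X → H) (hb : ∀ x, b x ∈ N) : ρ (SemidirectProduct.inl b) = 1 := by
  classical
  suffices h : ∀ x, ∀ n ∈ N, ρ (PermWreath.single Q x n) = 1 from
    Subgroup.pi_mem_of_mulSingle_mem (H := (MonoidHom.ker ρ).comap
      (SemidirectProduct.inl : (X → H) →* PermWreath H X Q)) b fun x => h x _ (hb x)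
  let ρ' (x : X) : Representation ℂ H V := ρ.comp (PermWreath.single Q x)
  -- Either some factor of `H^X` acts irreducibly on `V`, or each one acts reducibly and `hN`
  -- applies to its proper invariant subspaces, of dimension at most `d`.
  by_cases hirr : ∃ x, (ρ' x).IsIrreducible
  · obtain ⟨x, hx⟩ := hirr
    have : Nontrivial X := (Finite.one_lt_card_iff_nontrivial).mp hX
    obtain ⟨y, hxy⟩ := exists_ne x
    have hscal : ∀ h, ∃ c : ℂ, ρ' y h = c • 1 := fun h =>
      Representation.IsIrreducible.exists_eq_smul_one (ρ' x) (ρ' y h) fun h' =>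
        (PermWreath.commute_single hxy h h').map ρ
    have hy : ∀ h, ρ' y h = 1 := by
      refine Group.IsPerfect.map_eq_one_of_commute (ρ' y) fun a b => ?_
      obtain ⟨c, hc⟩ := hscal a
      rw [hc]
      exact (Commute.one_left _).smul_left c
    intro z n _
    -- All factors are conjugate under `Q`, so triviality at `y` passes to every `z`, including `x`
    -- itself.
    obtain ⟨q, rfl⟩ := MulAction.exists_smul_eq Q y z
    rw [← PermWreath.inr_mul_single_mul_inv, map_mul, map_mul, show ρ (single Q y n) = 1 from hy n,
      mul_one, ← map_mul, mul_inv_cancel, map_one]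
  · intro x n hn
    refine Representation.apply_eq_one_of_not_isIrreducible (ρ' x) (fun h => hirr ⟨x, h⟩) n
      fun U hU => hN _ U.toRepresentation (by omega) n hn

/-! ### Truncation maps -/

namespace IterWreath

section

variable (Q : Type u) (X : Type v) [Group Q] [MulAction Q X]

instance finite [Finite Q] [Finite X] : ∀ k, Finite (IterWreath Q X k)
  | 0 => inferInstanceAs (Finite PUnit)
  | k + 1 =>
    have := IterWreath.finite k
    Finite.of_equiv _ (SemidirectProduct.equivProd (N := X → IterWreath Q X k) (G := Q)
      (φ := mulAutArrow)).symm

instance : Subsingleton (IterWreath Q X 0) := inferInstanceAs (Subsingleton PUnit)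

instance isPerfect [Finite X] [Group.IsPerfect Q] : ∀ k, Group.IsPerfect (IterWreath Q X k)
  | 0 => inferInstance
  | k + 1 =>
    have := IterWreath.isPerfect k
    inferInstanceAs (Group.IsPerfect (PermWreath (IterWreath Q X k) X Q))

/-- The canonical map `W(Q,m) → W(Q,k)`: the iterated projection if `k ≤ m`, and its canonical
section if `m ≤ k`. -/
def trunc : (m k : ℕ) → IterWreath Q X m →* IterWreath Q X k
  | _, 0 => 1
  | 0, _ + 1 => 1
  | m + 1, k + 1 => PermWreath.map X Q (trunc m k)

end

variable {Q : Type u} {X : Type v} [Group Q] [MulAction Q X]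

theorem trunc_self (k : ℕ) (g : IterWreath Q X k) : trunc Q X k k g = g := by
  induction k with
  | zero => exact Subsingleton.elim _ _
  | succ k ih => exact SemidirectProduct.ext (funext fun x => ih (g.left x)) rfl

/-- No relation between `m` and `k` is needed, so the truncations of a single element form a point
of the inverse limit. -/
theorem proj_trunc (m k : ℕ) (g : IterWreath Q X m) :
    proj Q X k (trunc Q X m (k + 1) g) = trunc Q X m k g := by
  induction k generalizing m with
  | zero => exact Subsingleton.elim _ _
  | succ k ih =>
    cases m with
    | zero => exact map_one _
    | succ m => exact SemidirectProduct.ext (funext fun x => ih m (g.left x)) rfl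

theorem trunc_proj {m k : ℕ} (hk : k ≤ m) (g : IterWreath Q X (m + 1)) :
    trunc Q X m k (proj Q X m g) = trunc Q X (m + 1) k g := by
  induction k generalizing m with
  | zero => exact Subsingleton.elim _ _
  | succ k ih =>
    obtain ⟨m, rfl⟩ : ∃ l, m = l + 1 := ⟨m - 1, by omega⟩
    exact SemidirectProduct.ext (funext fun x => ih (by omega) (g.left x)) rfl

/-- Representations of degree at most `k + 1` of `W(Q,m)` factor through `W(Q,k)`. -/
theorem apply_eq_one_of_trunc_eq_one [Finite Q] [Finite X] [MulAction.IsPretransitive Q X]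
    [Group.IsPerfect Q] (hX : 2 ≤ Nat.card X) (k m : ℕ) (V : Type) [AddCommGroup V] [Module ℂ V]
    [FiniteDimensional ℂ V] (ρ : Representation ℂ (IterWreath Q X m) V)
    (hV : Module.finrank ℂ V ≤ k + 1) (g : IterWreath Q X m) (hg : trunc Q X m k g = 1) :
    ρ g = 1 := by
  induction k generalizing m V with
  | zero => exact Representation.finrank_le_one_apply_eq_one hV ρ g
  | succ k ih =>
    cases m with
    | zero => rw [Subsingleton.elim g 1, map_one]
    | succ m =>
      -- The kernel of `trunc` lies in the base group and consists of the functions with values in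
      -- the kernel one level down.
      have hright : g.right = 1 := congrArg SemidirectProduct.right hg
      have hleft : ∀ x, trunc Q X m k (g.left x) = 1 :=
        congrFun (congrArg SemidirectProduct.left hg)
      have hg' : g = (SemidirectProduct.inl g.left : PermWreath (IterWreath Q X m) X Q) :=
        SemidirectProduct.ext rfl hright
      rw [hg']
      exact PermWreath.apply_inl_eq_one hX {h | trunc Q X m k h = 1} (k + 1)
        (fun V _ _ _ ρ hV n hn => ih m V ρ hV n hn) V ρ hV g.left hleft

end IterWreath

namespace WProf

variable {Q : Type u} {X : Type v} [Group Q] [MulAction Q X]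

theorem trunc_apply (g : WProf Q X) {k m : ℕ} (h : k ≤ m) :
    IterWreath.trunc Q X m k (g.1 m) = g.1 k := by
  induction m, h using Nat.le_induction with
  | base => exact IterWreath.trunc_self k _
  | succ m hm ih => rw [← IterWreath.trunc_proj hm, g.2 m, ih]

theorem apply_eq_one_of_le (g : WProf Q X) {k m : ℕ} (h : k ≤ m) (hg : g.1 m = 1) :
    g.1 k = 1 := by
  rw [← trunc_apply g h, hg, map_one]

variable (Q X) in
/-- The canonical section of the projection `W^prof(Q) → W(Q,k)`. -/
def ofIterWreath (k : ℕ) : IterWreath Q X k →* WProf Q X where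
  toFun g := ⟨fun m => IterWreath.trunc Q X k m g, fun m => IterWreath.proj_trunc k m g⟩
  map_one' := Subtype.ext (funext fun _ => map_one _)
  map_mul' _ _ := Subtype.ext (funext fun _ => map_mul _ _ _)

variable (Q X) in
/-- The projection `W^prof(Q) → W(Q,k)`. -/
def toIterWreath (k : ℕ) : WProf Q X →* IterWreath Q X k :=
  (Pi.evalMonoidHom _ k).comp (WProf Q X).subtype

theorem continuous_toIterWreath (k : ℕ) : Continuous (toIterWreath Q X k) :=
  (continuous_apply k).comp continuous_subtype_val

theorem toIterWreath_ofIterWreath_self (k : ℕ) (g : IterWreath Q X k) :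
    toIterWreath Q X k (ofIterWreath Q X k g) = g := IterWreath.trunc_self k g

theorem exists_forall_apply_eq_one_mem {U : Set (WProf Q X)} (hU : U ∈ nhds 1) (k : ℕ) :
    ∃ m, k ≤ m ∧ ∀ g, toIterWreath Q X m g = 1 → g ∈ U := by
  obtain ⟨t, ht, htU⟩ := (mem_nhds_subtype _ _ _).mp hU
  rw [nhds_pi, Filter.mem_pi'] at ht
  obtain ⟨I, s, hs, hst⟩ := ht
  -- A basic neighbourhood restricts only the coordinates in `I`; by coherence, triviality at a
  -- level above them all suffices.
  refine ⟨max k (I.sup id), le_max_left _ _, fun g hg => htU (hst fun i hi => ?_)⟩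
  have h1 : g.1 i = 1 :=
    apply_eq_one_of_le g ((Finset.le_sup (f := id) hi).trans (le_max_right _ _)) hg
  rw [h1]
  exact mem_of_mem_nhds (hs i)

end WProf

theorem MonoidHom.apply_eq_apply_section {G H M : Type*} [Group G] [Group H] [Monoid M]
    (f : G →* M) {p : G →* H} {s : H →* G} (hs : ∀ h, p (s h) = h)
    (hf : ∀ g, p g = 1 → f g = 1) (g : G) : f g = f (s (p g)) := by
  have h : f (g * (s (p g))⁻¹) = 1 := hf _ (by rw [map_mul, map_inv, hs, mul_inv_cancel])
  rw [← one_mul (f (s (p g))), ← h, ← map_mul, inv_mul_cancel_right]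

/-! ### No small subgroups -/

/-- A subgroup of the units of a normed algebra contained in a small neighbourhood of `1` is
trivial. -/
theorem MonoidHom.apply_eq_one_of_norm_sub_one_le {G A : Type*} [Group G] [NormedRing A]
    [NormedAlgebra ℂ A] (f : G →* A) (hf : ∀ g, ‖f g - 1‖ ≤ 1 / 2) (g : G) : f g = 1 := by
  -- With `a = f g - 1`, `f (g * g) - 1 = 2a + a²` has norm at least `(2 - 1/2)‖a‖`. Repeated
  -- squaring would leave the ball unless `a = 0`.
  have hsq : ∀ g, 3 / 2 * ‖f g - 1‖ ≤ ‖f (g * g) - 1‖ := fun g => by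
    have h1 : 2 • (f g - 1) = (f (g * g) - 1) - (f g - 1) * (f g - 1) := by
      rw [map_mul]; noncomm_ring
    have h2 : ‖2 • (f g - 1)‖ = 2 * ‖f g - 1‖ := by
      rw [RCLike.norm_nsmul ℂ, nsmul_eq_mul, Nat.cast_ofNat]
    have h3 := norm_sub_le (f (g * g) - 1) ((f g - 1) * (f g - 1))
    rw [← h1, h2] at h3
    have h4 := norm_mul_le (f g - 1) (f g - 1)
    nlinarith [hf g, norm_nonneg (f g - 1)]
  have hpow : ∀ (n : ℕ) g, (3 / 2) ^ n * ‖f g - 1‖ ≤ 1 / 2 := fun n => by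
    induction n with
    | zero => simpa using hf
    | succ n ih =>
      intro g
      rw [pow_succ, mul_assoc]
      exact (mul_le_mul_of_nonneg_left (hsq g) (by positivity)).trans (ih _)
  by_contra hne
  have hpos : 0 < ‖f g - 1‖ := norm_pos_iff.mpr (sub_ne_zero.mpr hne)
  obtain ⟨n, hn⟩ := pow_unbounded_of_one_lt (1 / 2 / ‖f g - 1‖) (by norm_num : (1 : ℝ) < 3 / 2)
  rw [div_lt_iff₀ hpos] at hn
  exact absurd (hpow n g) (not_le.mpr hn)

/-! ### Factorisation of continuous representations through finite levels -/

namespace WProf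

variable {Q : Type u} {X : Type v} [Group Q] [MulAction Q X]

/-- Continuous representations of `W^prof(Q)` on `ℂ^n` factor through some `W(Q,m)`. -/
theorem exists_apply_eq_one {n : ℕ} (ρ : Representation ℂ (WProf Q X) (Fin n → ℂ))
    (hρ : ∀ v, Continuous fun g => ρ g v) (k : ℕ) :
    ∃ m, k ≤ m ∧ ∀ g, toIterWreath Q X m g = 1 → ρ g = 1 := by
  let F : WProf Q X →* ((Fin n → ℂ) →L[ℂ] (Fin n → ℂ)) :=
    (Module.End.toContinuousLinearMap (𝕜 := ℂ) (Fin n → ℂ)).toRingEquiv.toRingHom.toMonoidHom.comp ρ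
  have hF : Continuous F := continuous_clm_apply.mpr hρ
  have hU : F ⁻¹' Metric.closedBall 1 (1 / 2) ∈ nhds 1 :=
    hF.continuousAt.preimage_mem_nhds (by
      rw [map_one]; exact Metric.closedBall_mem_nhds 1 (by norm_num))
  obtain ⟨m, hm, hmU⟩ := exists_forall_apply_eq_one_mem hU k
  refine ⟨m, hm, fun g hg => ?_⟩
  have h := (F.comp (toIterWreath Q X m).ker.subtype).apply_eq_one_of_norm_sub_one_le
    (fun h => by simpa [dist_eq_norm] using hmU h.1 h.2) ⟨g, hg⟩
  exact LinearMap.ext fun v => DFunLike.congr_fun h v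

/-- Continuity gives a level `m` depending on `ρ`; the degree bound then lowers it to `k`, uniformly
in `ρ`. -/
theorem apply_eq_apply_ofIterWreath [Finite Q] [Finite X] [MulAction.IsPretransitive Q X]
    [Group.IsPerfect Q] (hX : 2 ≤ Nat.card X) {k : ℕ}
    (ρ : Representation ℂ (WProf Q X) (Fin (k + 1) → ℂ))
    (hρ : ∀ v, Continuous fun g => ρ g v) (g : WProf Q X) :
    ρ g = ρ (ofIterWreath Q X k (toIterWreath Q X k g)) := by
  obtain ⟨m, hkm, hm⟩ := exists_apply_eq_one ρ hρ k
  refine MonoidHom.apply_eq_apply_section ρ (toIterWreath_ofIterWreath_self k) (fun g hg => ?_) g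
  rw [MonoidHom.apply_eq_apply_section ρ (toIterWreath_ofIterWreath_self m) hm g]
  refine IterWreath.apply_eq_one_of_trunc_eq_one hX k m _
    (ρ.comp (ofIterWreath Q X m)) (by simp) _ ?_
  exact (trunc_apply g hkm).trans hg

end WProf

/-! ### Perfect groups give rigid limits -/

namespace WProf

variable {Q : Type u} {X : Type v} [Group Q] [MulAction Q X]

theorem isRigid_of_isPerfect [Finite Q] [Finite X] [MulAction.IsPretransitive Q X]
    [Group.IsPerfect Q] (hX : 2 ≤ Nat.card X) : IsRigid (WProf Q X) := by
  intro n hn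
  obtain ⟨k, rfl⟩ : ∃ k, n = k + 1 := ⟨n - 1, by omega⟩
  have hfac := fun ρ : ContIrrep (WProf Q X) (k + 1) => apply_eq_apply_ofIterWreath hX ρ.1 ρ.2.2
  let res (ρ : ContIrrep (WProf Q X) (k + 1)) : ContIrrep (IterWreath Q X k) (k + 1) :=
    ⟨ρ.1.comp (ofIterWreath Q X k), by
      have := ρ.2.1
      -- By `hfac` both representations have the same image, hence the same invariant subspaces, so
      -- irreducibility survives restriction.
      let e : Subrepresentation (ρ.1.comp (ofIterWreath Q X k)) ≃o Subrepresentation ρ.1 :=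
        { toFun := fun U => ⟨U.toSubmodule, fun g v hv => by
            rw [hfac ρ g]; exact U.apply_mem_toSubmodule _ hv⟩
          invFun := fun U => ⟨U.toSubmodule, fun g v hv => U.apply_mem_toSubmodule _ hv⟩
          left_inv := fun _ => rfl
          right_inv := fun _ => rfl
          map_rel_iff' := Iff.rfl }
      exact e.isSimpleOrder, fun v => continuous_of_discreteTopology⟩
  have := ContIrrep.finite_quotient_of_finite (IterWreath Q X k) (k + 1)
  have hfin : Finite (Quotient (ContIrrep.setoid (WProf Q X) (k + 1))) := by
    refine Finite.of_injective (β := Quotient (ContIrrep.setoid (IterWreath Q X k) (k + 1)))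
      (fun q => Quotient.mk _ (res q.out)) fun q q' h => ?_
    obtain ⟨e⟩ := Quotient.exact h
    rw [← q.out_eq, ← q'.out_eq]
    refine Quotient.sound ⟨.mk e.toLinearEquiv fun g => ?_⟩
    rw [hfac q.out, hfac q'.out]
    exact e.isIntertwining' _
  exact ENat.card_lt_top.mpr hfin

end WProf

/-! ### Characters of iterated wreath products -/

/-- The homomorphism `(b, q) ↦ ∏ x, f (b x)` on `H ≀_X Q`. -/
def PermWreath.prodHom {H : Type w} (X : Type v) (Q : Type u) [Group H] [Group Q] [MulAction Q X]
    [Fintype X] {A : Type*} [CommGroup A] (f : H →* A) : PermWreath H X Q →* A where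
  toFun g := ∏ x, f (g.left x)
  map_one' := by simp
  map_mul' g h := by
    have h1 : ∀ x, (g * h).left x = g.left x * h.left (g.right⁻¹ • x) := fun _ => rfl
    simp only [h1, map_mul, Finset.prod_mul_distrib]
    -- The twist by `Q` only permutes the factors of a product in a commutative group.
    rw [Fintype.prod_equiv (MulAction.toPerm g.right⁻¹) (fun x => f (h.left (g.right⁻¹ • x)))
      (fun x => f (h.left x)) fun _ => rfl]

namespace IterWreath

variable {Q : Type u} (X : Type v) [Group Q] [MulAction Q X]

/-- The character of `W(Q,j+1)` obtained by multiplying the values of `χ` over the vertices of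
level `j`. -/
def levelChar [Fintype X] {A : Type*} [CommGroup A] (χ : Q →* A) : (j : ℕ) → IterWreath Q X (j + 1) →* A
  | 0 => χ.comp SemidirectProduct.rightHom
  | j + 1 => PermWreath.prodHom X Q (levelChar χ j)

/-- The element of `W(Q,j+1)` acting by `q` at the vertex `x ⋯ x` of level `j`, and trivially
elsewhere. -/
def atLevel [DecidableEq X] (x : X) (q : Q) : (j : ℕ) → IterWreath Q X (j + 1)
  | 0 => SemidirectProduct.inr q
  | j + 1 => PermWreath.single Q x (atLevel x q j)

theorem levelChar_atLevel [Fintype X] [DecidableEq X] {A : Type*} [CommGroup A] (χ : Q →* A) (x : X) (q : Q)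
    (j : ℕ) : levelChar X χ j (atLevel X x q j) = χ q := by
  induction j with
  | zero => rfl
  | succ j ih =>
    refine (Finset.prod_eq_single x (fun y _ hy => ?_) (by simp)).trans ?_
    · exact (congrArg _ (Pi.mulSingle_eq_of_ne hy _)).trans (map_one _)
    · exact (congrArg _ (Pi.mulSingle_eq_same x _)).trans ih

theorem trunc_atLevel [DecidableEq X] (x : X) (q : Q) {i j : ℕ} (hij : i ≤ j) :
    trunc Q X (j + 1) i (atLevel X x q j) = 1 := by
  induction i generalizing j with
  | zero => exact Subsingleton.elim _ _
  | succ i ih =>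
    obtain ⟨j, rfl⟩ : ∃ l, j = l + 1 := ⟨j - 1, by omega⟩
    refine SemidirectProduct.ext (funext fun y => ?_) rfl
    change trunc Q X (j + 1) i ((Pi.mulSingle x (atLevel X x q j) : X → IterWreath Q X (j + 1)) y)
      = 1
    by_cases h : y = x
    · subst h; rw [Pi.mulSingle_eq_same, ih (by omega)]
    · rw [Pi.mulSingle_eq_of_ne h, map_one]

end IterWreath

/-- The one-dimensional representation given by a continuous character. -/
def ContIrrep.ofChar {G : Type w} [Group G] [TopologicalSpace G] (χ : G →* ℂˣ)
    (hχ : Continuous fun g => (χ g : ℂ)) : ContIrrep G 1 :=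
  ⟨((algebraMap ℂ (Module.End ℂ (Fin 1 → ℂ))).toMonoidHom.comp (Units.coeHom ℂ)).comp χ, by
    have hs : IsSimpleOrder (Submodule ℂ (Fin 1 → ℂ)) :=
      is_simple_module_of_finrank_eq_one (K := ℂ) (by simp)
    have : Nontrivial (Subrepresentation (((algebraMap ℂ (Module.End ℂ
        (Fin 1 → ℂ))).toMonoidHom.comp (Units.coeHom ℂ)).comp χ)) :=
      ⟨⊥, ⊤, fun h => bot_ne_top (α := Submodule ℂ (Fin 1 → ℂ)) (congrArg (·.toSubmodule) h)⟩
    exact ⟨fun U => (eq_bot_or_eq_top U.toSubmodule).imp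
      (fun h => Subrepresentation.toSubmodule_injective h)
      (fun h => Subrepresentation.toSubmodule_injective h)⟩,
    fun v => hχ.smul continuous_const⟩

/-- Scalars commute with any linear isomorphism, so equivalence forces equal characters. -/
theorem ContIrrep.eq_of_ofChar_equiv {G : Type w} [Group G] [TopologicalSpace G] {χ χ' : G →* ℂˣ}
    {hχ : Continuous fun g => (χ g : ℂ)} {hχ' : Continuous fun g => (χ' g : ℂ)}
    (h : ContIrrep.ofChar χ hχ ≈ ContIrrep.ofChar χ' hχ') : χ = χ' := by
  obtain ⟨e⟩ := h
  ext g
  have h1 : e.toLinearEquiv ((χ g : ℂ) • 1) = (χ' g : ℂ) • e.toLinearEquiv 1 :=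
    LinearMap.congr_fun (e.isIntertwining' g) 1
  rw [map_smul] at h1
  exact smul_left_injective ℂ (by simp) h1

/-! ### Rigidity forces perfectness -/

namespace WProf

variable {Q : Type u} {X : Type v} [Group Q] [MulAction Q X]

theorem isPerfect_of_isRigid [Finite Q] [Finite X] [Nonempty X] (h : IsRigid (WProf Q X)) :
    Group.IsPerfect Q := by
  classical
  have := Fintype.ofFinite X
  by_contra hQ
  obtain ⟨χ, q, hq⟩ := Group.exists_hom_units_complex_ne_one hQ
  let ψ (j : ℕ) : WProf Q X →* ℂˣ := (IterWreath.levelChar X χ j).comp (toIterWreath Q X (j + 1))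
  have hψ : ∀ j, Continuous fun g => (ψ j g : ℂ) := fun j =>
    (continuous_of_discreteTopology (f := fun g => (IterWreath.levelChar X χ j g : ℂ))).comp
      (continuous_toIterWreath (j + 1))
  -- An element supported at level `j` is invisible in `W(Q,i+1)`, since `i < j` means `i + 1 ≤ j`,
  -- whereas `ψ j` takes the value `χ q ≠ 1` on it.
  have hne : ∀ i j, i < j → ψ i ≠ ψ j := fun i j hij heq => by
    let g := ofIterWreath Q X (j + 1) (IterWreath.atLevel X (Classical.arbitrary X) q j)
    have hi : ψ i g = 1 := (congrArg (IterWreath.levelChar X χ i)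
      (IterWreath.trunc_atLevel X _ q hij)).trans (map_one (IterWreath.levelChar X χ i))
    have hj : ψ j g = χ q := (congrArg _ (IterWreath.trunc_self (j + 1) _)).trans
      (IterWreath.levelChar_atLevel X χ _ q j)
    exact hq (by rw [← hj, ← heq, hi])
  have hinj : Function.Injective fun j =>
      (Quotient.mk (ContIrrep.setoid (WProf Q X) 1) (ContIrrep.ofChar (ψ j) (hψ j))) := by
    intro i j hij
    have heq := ContIrrep.eq_of_ofChar_equiv (Quotient.exact hij)
    rcases lt_trichotomy i j with hlt | heq' | hlt
    · exact (hne i j hlt heq).elim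
    · exact heq'
    · exact (hne j i hlt heq.symm).elim
  have hfin : Finite (Quotient (ContIrrep.setoid (WProf Q X) 1)) :=
    ENat.card_lt_top.mp (h 1 le_rfl)
  have := Finite.of_injective _ hinj
  exact not_finite ℕ

end WProf

theorem theorem2 (Q : Type u) (X : Type v) [Group Q] [Finite Q] [Finite X] [MulAction Q X]
    [MulAction.IsPretransitive Q X] (hX : 2 ≤ Nat.card X) :
    Group.IsPerfect Q ↔ IsRigid (WProf Q X) := by
  have : Nonempty X := (Nat.card_pos_iff.mp (by omega)).1
  exact ⟨fun _ => WProf.isRigid_of_isPerfect hX, WProf.isPerfect_of_isRigid⟩
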